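/- Let $G=(N,E)$ be a finite undirected graph with link capacities $c_{ij}=c_{ji}\ge 0$, let $s,d\in N$ be a source and a destination, and let $D_k=(N,E_k)$ be a directed acyclic graph obtained by giving each link of $G$ one of its two directions. For $A,B\subseteq N$ put $\operatorname{cap}_k(A,B)=\sum_{(i,j)\in E_k,\ i\in A,\ j\in B}c_{ij}$. A cut is a partition $(A,A^c)$ of $N$ with $s\in A$, $d\in A^c$; a min-cut is a cut of minimum $\operatorname{cap}_k(A,A^c)$ (this minimum is the max-flow $f_k^{\max}$ of $D_k$), and a smallest min-cut is a min-cut with the fewest nodes in $A$. Time is slotted. In slot $t=0,1,2,\dots$ an amount $A(t)\ge 0$ of data arrives at $s$, where $(A(t))_{t\ge0}$ is a random process with $\frac1t\sum_{\tau=0}^{t-1}A(\tau)\to\lambda$ almost surely. Node $n$ has backlog $Q_n(t)\ge 0$ at the start of slot $t$, with deterministic initial values $Q_n(0)\ge 0$, and $Q_d(t)=0$ for all $t$; for $n\ne d$, $$Q_n(t+1)=Q_n(t)+1_{[n=s]}A(t)+\sum_{i:(i,n)\in E_k}F_{in}(t)-\sum_{j:(n,j)\in E_k}F_{nj}(t).$$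 The transmissions $F_{ij}(t)$ follow the backpressure rule on $D_k$: data is sent over $(i,j)\in E_k$ only if $Q_i(t)>Q_j(t)$, with $0\le F_{ij}(t)\le c_{ij}$, and each node $i$ serves these links at full capacity as far as its backlog suffices, that is, $\sum_jF_{ij}(t)=\min\{Q_i(t),\ \sum_{j:(i,j)\in E_k,\,Q_i(t)>Q_j(t)}c_{ij}\}$ (the division of an insufficient backlog among the links is arbitrary). **Theorem.** Let $(A_k,A_k^c)$ be a smallest min-cut of $D_k$ with capacity $f_k^{\max}=\operatorname{cap}_k(A_k,A_k^c)<\lambda$, and let data be routed by backpressure on $D_k$. Then there are a finite constant $R$, depending only on the network data ($D_k$, $c$, $s$, $d$, $A_k$, $\lambda$) and on the initial backlogs, and a finite $T$, depending only on these and on the realization of the arrival sequence (so $T$ is a constant when the arrivals are deterministic), such that almost surely 1. for some $t<T$, $Q_n(t)>R$ for all $n\in A_k$ (simultaneously), and 2. for all $t$, $Q_n(t)<R$ for all $n\in A_k^c$. -/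

import Mathlib

open Filter Topology MeasureTheory

/-- A directed acyclic graph embedded in the undirected graph `G`: every link `{i, j}` of `G` is
given exactly one of its two directions, there are no other links, and no directed cycle. -/
structure EmbeddedDAG {N : Type*} (G : SimpleGraph N) where
  /-- `link i j` says that the directed link `(i, j)` belongs to the DAG. -/
  link : N → N → Prop
  adj_of_link : ∀ i j, link i j → G.Adj i j
  link_or_link : ∀ i j, G.Adj i j → link i j ∨ link j i
  not_both : ∀ i j, link i j → ¬ link j i
  acyclic : ∀ i, ¬ Relation.TransGen link i i

namespace EmbeddedDAG

variable {N : Type*} {G : SimpleGraph N}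

open scoped Classical in
/-- Total capacity of the directed links that go from `A` to `B`.  The capacity of a directed link
`(i, j)` is the capacity `c s(i, j)` of the undirected link `{i, j}`. -/
noncomputable def cap (D : EmbeddedDAG G) (c : Sym2 N → ℝ) (A B : Finset N) : ℝ :=
  ∑ i ∈ A, ∑ j ∈ B, if D.link i j then c s(i, j) else 0

/-- `(A, Aᶜ)` is a cut: the source lies in `A`, the destination in its complement. -/
def IsCut (s d : N) (A : Finset N) : Prop :=
  s ∈ A ∧ d ∉ A

/-- `(A, Aᶜ)` is a cut of minimum capacity. -/
def IsMinCut [Fintype N] [DecidableEq N] (D : EmbeddedDAG G) (c : Sym2 N → ℝ) (s d : N)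
    (A : Finset N) : Prop :=
  IsCut s d A ∧ ∀ B : Finset N, IsCut s d B → D.cap c A Aᶜ ≤ D.cap c B Bᶜ

/-- `(A, Aᶜ)` is a min-cut with the smallest number of nodes on the source side. -/
def IsSmallestMinCut [Fintype N] [DecidableEq N] (D : EmbeddedDAG G) (c : Sym2 N → ℝ) (s d : N)
    (A : Finset N) : Prop :=
  D.IsMinCut c s d A ∧ ∀ B : Finset N, D.IsMinCut c s d B → A.card ≤ B.card

open scoped Classical in
/-- `F` is a possible outcome of one slot of backpressure when the backlogs are `q`: a link `(i, j)`
is used only if `q i > q j`, it carries at most its capacity, and each node serves its usable links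
at full capacity as far as its backlog suffices, i.e. it sends in total the minimum of its backlog
and the capacity of its usable links.  So a node with one usable link `(i, j)` sends
`min (c s(i, j)) (q i)` over it, and a node whose backlog covers all its usable links fills all of
them; how a smaller backlog is divided among the usable links is left open. -/
structure IsBackpressureSlot [Fintype N] (D : EmbeddedDAG G) (c : Sym2 N → ℝ)
    (q : N → ℝ) (F : N → N → ℝ) : Prop where
  nonneg : ∀ i j, 0 ≤ F i j
  le_capacity : ∀ i j, D.link i j → F i j ≤ c s(i, j)
  eq_zero : ∀ i j, ¬ (D.link i j ∧ q j < q i) → F i j = 0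
  total : ∀ i, ∑ j, F i j = min (q i) (∑ j, if D.link i j ∧ q j < q i then c s(i, j) else 0)

open scoped Classical in
/-- A sample path of the slotted queueing network under backpressure: `a t` is the amount of data
arriving at the source in slot `t`, `Q t n` the backlog of node `n` at the start of slot `t`, and
`F t i j` the amount sent over the link `(i, j)` in slot `t`.  The destination keeps no backlog. -/
structure IsBackpressurePath [Fintype N] (D : EmbeddedDAG G) (c : Sym2 N → ℝ)
    (s d : N) (Q₀ : N → ℝ) (a : ℕ → ℝ) (Q : ℕ → N → ℝ) (F : ℕ → N → N → ℝ) : Prop where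
  arrival_nonneg : ∀ t, 0 ≤ a t
  initial : Q 0 = Q₀
  dest : ∀ t, Q t d = 0
  slot : ∀ t, D.IsBackpressureSlot c (Q t) (F t)
  update : ∀ t n, n ≠ d →
    Q (t + 1) n = Q t n + (if n = s then a t else 0) + ∑ i, F t i n - ∑ j, F t n j

end EmbeddedDAG

/-! Each half is an induction over time, run on all subsets `U` of one side of the cut at once.
Write `m` for the number of nodes and `u` for the size of `U`. On the destination side the backlog
of `U` stays below `K u (2m - u)` (`sum_le_concave`). Well below this bound, one slot cannot break
it. Close to it, comparison with the sets having one node more or fewer, by concavity, puts every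
node of `U` above the rest of its side. Backpressure then brings nothing in from the rest and fills
every link towards it, so minimality of the cut keeps `U` from growing. The source side is the
mirror image (`convex_le_sum`): a lower bound convex in `u` and rising linearly in time. A nonempty
set close to it lies below the rest of `A`, and gains at least a fixed `ε` per slot because the
min-cut is smallest and its capacity is below `lam` (`exists_gain`). Arrivals are replaced by their
trend, at an error small relative to the time horizon. -/

namespace EmbeddedDAG

variable {N : Type*} {G : SimpleGraph N}

/-! ### Capacities and inequalities for min-cuts -/

open scoped Classical in
/-- The capacity of the ordered pair `(i, j)`, zero when it is not a link of the DAG. -/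
noncomputable def rate (D : EmbeddedDAG G) (c : Sym2 N → ℝ) (i j : N) : ℝ :=
  if D.link i j then c s(i, j) else 0

theorem cap_eq_sum_rate (D : EmbeddedDAG G) (c : Sym2 N → ℝ) (A B : Finset N) :
    D.cap c A B = ∑ i ∈ A, ∑ j ∈ B, D.rate c i j := rfl

theorem rate_nonneg (D : EmbeddedDAG G) {c : Sym2 N → ℝ} (hc : ∀ e ∈ G.edgeSet, 0 ≤ c e)
    (i j : N) : 0 ≤ D.rate c i j := by
  unfold rate
  split_ifs with h
  · exact hc _ (D.adj_of_link i j h)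
  · exact le_rfl

theorem cap_nonneg (D : EmbeddedDAG G) {c : Sym2 N → ℝ} (hc : ∀ e ∈ G.edgeSet, 0 ≤ c e)
    (A B : Finset N) : 0 ≤ D.cap c A B :=
  Finset.sum_nonneg fun i _ => Finset.sum_nonneg fun j _ => D.rate_nonneg hc i j

theorem cap_mono (D : EmbeddedDAG G) {c : Sym2 N → ℝ} (hc : ∀ e ∈ G.edgeSet, 0 ≤ c e)
    {A A' B B' : Finset N} (hA : A ⊆ A') (hB : B ⊆ B') : D.cap c A B ≤ D.cap c A' B' := by
  rw [cap_eq_sum_rate, cap_eq_sum_rate]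
  calc ∑ i ∈ A, ∑ j ∈ B, D.rate c i j ≤ ∑ i ∈ A, ∑ j ∈ B', D.rate c i j :=
        Finset.sum_le_sum fun i _ =>
          Finset.sum_le_sum_of_subset_of_nonneg hB fun j _ _ => D.rate_nonneg hc i j
    _ ≤ ∑ i ∈ A', ∑ j ∈ B', D.rate c i j :=
        Finset.sum_le_sum_of_subset_of_nonneg hA fun i _ _ =>
          Finset.sum_nonneg fun j _ => D.rate_nonneg hc i j

theorem cap_union_left [DecidableEq N] (D : EmbeddedDAG G) (c : Sym2 N → ℝ) {A A' : Finset N}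
    (h : Disjoint A A') (B : Finset N) : D.cap c (A ∪ A') B = D.cap c A B + D.cap c A' B := by
  simp only [cap_eq_sum_rate, Finset.sum_union h]

theorem cap_union_right [DecidableEq N] (D : EmbeddedDAG G) (c : Sym2 N → ℝ) {B B' : Finset N}
    (h : Disjoint B B') (A : Finset N) : D.cap c A (B ∪ B') = D.cap c A B + D.cap c A B' := by
  simp only [cap_eq_sum_rate, Finset.sum_union h, Finset.sum_add_distrib]

/-- Enlarging the source side of a min-cut by `U` does not lower the capacity. -/
theorem IsMinCut.cap_le_cap_sdiff [Fintype N] [DecidableEq N] {D : EmbeddedDAG G}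
    {c : Sym2 N → ℝ} {s d : N} {A : Finset N} (hA : D.IsMinCut c s d A) {U : Finset N}
    (hU : U ⊆ Aᶜ) (hd : d ∉ U) : D.cap c A U ≤ D.cap c U (Aᶜ \ U) := by
  have hAU : Disjoint A U := Finset.disjoint_left.2 fun x hx hxU =>
    Finset.mem_compl.1 (hU hxU) hx
  have h := hA.2 (A ∪ U) ⟨Finset.mem_union_left _ hA.1.1, by
    simp only [Finset.mem_union, not_or]; exact ⟨hA.1.2, hd⟩⟩
  have e1 : (A ∪ U)ᶜ = Aᶜ \ U := by ext x; simp
  have e2 : D.cap c A Aᶜ = D.cap c A U + D.cap c A (Aᶜ \ U) := by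
    rw [← D.cap_union_right c Finset.disjoint_sdiff, Finset.union_sdiff_of_subset hU]
  rw [e1, D.cap_union_left c hAU, e2] at h
  linarith

/-- Removing a nonempty set `U` of nodes other than `s` from the source side of a smallest min-cut
raises the capacity. -/
theorem IsSmallestMinCut.cap_lt_cap_sdiff [Fintype N] [DecidableEq N] {D : EmbeddedDAG G}
    {c : Sym2 N → ℝ} {s d : N} {A : Finset N} (hA : D.IsSmallestMinCut c s d A) {U : Finset N}
    (hU : U ⊆ A) (hs : s ∉ U) (hne : U.Nonempty) : D.cap c U Aᶜ < D.cap c (A \ U) U := by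
  have hcut : IsCut s d (A \ U) :=
    ⟨Finset.mem_sdiff.2 ⟨hA.1.1.1, hs⟩, fun h => hA.1.1.2 (Finset.mem_sdiff.1 h).1⟩
  have hlt : D.cap c A Aᶜ < D.cap c (A \ U) (A \ U)ᶜ := by
    by_contra hcon
    have hmin : D.IsMinCut c s d (A \ U) :=
      ⟨hcut, fun B hB => (not_lt.1 hcon).trans (hA.1.2 B hB)⟩
    have h1 := hA.2 _ hmin
    have h2 := Finset.card_lt_card (Finset.sdiff_ssubset hU hne)
    omega
  have e1 : (A \ U)ᶜ = Aᶜ ∪ U := by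
    ext x; simp only [Finset.mem_compl, Finset.mem_sdiff, Finset.mem_union]; tauto
  have hdis : Disjoint Aᶜ U := Finset.disjoint_left.2 fun x hx hxU =>
    Finset.mem_compl.1 hx (hU hxU)
  have e2 : D.cap c A Aᶜ = D.cap c (A \ U) Aᶜ + D.cap c U Aᶜ := by
    rw [← D.cap_union_left c Finset.sdiff_disjoint, Finset.sdiff_union_of_subset hU]
  rw [e1, D.cap_union_right c hdis, e2] at hlt
  linarith

/-! ### Flows in one slot of backpressure -/

section Slot

variable [Fintype N] {D : EmbeddedDAG G} {c : Sym2 N → ℝ} {q : N → ℝ} {F : N → N → ℝ}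

theorem IsBackpressureSlot.le_rate (h : D.IsBackpressureSlot c q F) (i j : N) :
    F i j ≤ D.rate c i j := by
  unfold rate
  split_ifs with hl
  · exact h.le_capacity i j hl
  · exact (h.eq_zero i j fun h' => hl h'.1).le

theorem IsBackpressureSlot.eq_zero_of_le (h : D.IsBackpressureSlot c q F) {i j : N}
    (hij : q i ≤ q j) : F i j = 0 :=
  h.eq_zero i j fun h' => absurd h'.2 (not_lt.2 hij)

/-- A node with sufficient backlog fills all its usable links. -/
theorem IsBackpressureSlot.eq_rate (hc : ∀ e ∈ G.edgeSet, 0 ≤ c e)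
    (h : D.IsBackpressureSlot c q F) {i j : N} (hi : ∑ j, D.rate c i j ≤ q i)
    (hij : q j < q i) : F i j = D.rate c i j := by
  classical
  set r : N → ℝ := fun j => if D.link i j ∧ q j < q i then c s(i, j) else 0 with hr
  have hle : ∀ j ∈ Finset.univ, F i j ≤ r j := by
    intro j _
    simp only [hr]
    split_ifs with h'
    · exact h.le_capacity i j h'.1
    · exact (h.eq_zero i j h').le
  have hrr : ∑ j, r j ≤ ∑ j, D.rate c i j := by
    refine Finset.sum_le_sum fun j _ => ?_
    by_cases h' : D.link i j ∧ q j < q i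
    · simp [hr, rate, h'.1, h'.2]
    · simpa [hr, if_neg h'] using D.rate_nonneg hc i j
  have htot : ∑ j, F i j = ∑ j, r j := by
    have h1 : ∑ j, F i j = min (q i) (∑ j, r j) := by convert h.total i
    rw [h1, min_eq_right (hrr.trans hi)]
  -- Flows bounded termwise by the usable capacities, with equal totals, agree termwise.
  have := (Finset.sum_eq_sum_iff_of_le hle).1 htot j (Finset.mem_univ j)
  rw [this]
  simp [hr, rate, hij]

theorem IsBackpressureSlot.sum_le_backlog (h : D.IsBackpressureSlot c q F) (i : N) :
    ∑ j, F i j ≤ q i := (h.total i).trans_le (min_le_left _ _)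

/-- The flow from `X` to `Y` is at most the capacity. -/
theorem IsBackpressureSlot.flow_le_cap (h : D.IsBackpressureSlot c q F) (X Y : Finset N) :
    ∑ i ∈ X, ∑ j ∈ Y, F i j ≤ D.cap c X Y :=
  Finset.sum_le_sum fun i _ => Finset.sum_le_sum fun j _ => h.le_rate i j

theorem IsBackpressureSlot.flow_nonneg (h : D.IsBackpressureSlot c q F) (X Y : Finset N) :
    0 ≤ ∑ i ∈ X, ∑ j ∈ Y, F i j :=
  Finset.sum_nonneg fun i _ => Finset.sum_nonneg fun j _ => h.nonneg i j

theorem IsBackpressureSlot.flow_eq_zero (h : D.IsBackpressureSlot c q F) {X Y : Finset N}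
    (hXY : ∀ i ∈ X, ∀ j ∈ Y, q i ≤ q j) : ∑ i ∈ X, ∑ j ∈ Y, F i j = 0 :=
  Finset.sum_eq_zero fun i hi => Finset.sum_eq_zero fun j hj => h.eq_zero_of_le (hXY i hi j hj)

/-- The total capacity of the DAG dominates the outgoing capacity of every node, so it serves as a
uniform threshold for sufficient backlog. -/
theorem IsBackpressureSlot.flow_eq_cap (hc : ∀ e ∈ G.edgeSet, 0 ≤ c e)
    (h : D.IsBackpressureSlot c q F) {X Y : Finset N}
    (hX : ∀ i ∈ X, ∀ j ∈ Y, D.cap c Finset.univ Finset.univ ≤ q i)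
    (hXY : ∀ i ∈ X, ∀ j ∈ Y, q j < q i) : ∑ i ∈ X, ∑ j ∈ Y, F i j = D.cap c X Y := by
  rw [cap_eq_sum_rate]
  refine Finset.sum_congr rfl fun i hi => Finset.sum_congr rfl fun j hj => ?_
  refine h.eq_rate hc (le_trans ?_ (hX i hi j hj)) (hXY i hi j hj)
  rw [cap_eq_sum_rate]
  exact Finset.single_le_sum (f := fun i => ∑ j, D.rate c i j)
    (fun i _ => Finset.sum_nonneg fun j _ => D.rate_nonneg hc i j) (Finset.mem_univ i)

end Slot

theorem sum_inflow_sub_outflow [Fintype N] [DecidableEq N] (F : N → N → ℝ) (U : Finset N) :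
    ∑ n ∈ U, (∑ i, F i n - ∑ j, F n j) =
      ∑ i ∈ Uᶜ, ∑ j ∈ U, F i j - ∑ i ∈ U, ∑ j ∈ Uᶜ, F i j := by
  have h1 : ∑ n ∈ U, ∑ i, F i n = ∑ i ∈ U, ∑ j ∈ U, F i j + ∑ i ∈ Uᶜ, ∑ j ∈ U, F i j := by
    rw [Finset.sum_comm, ← Finset.sum_add_sum_compl U]
  have h2 : ∑ n ∈ U, ∑ j, F n j = ∑ i ∈ U, ∑ j ∈ U, F i j + ∑ i ∈ U, ∑ j ∈ Uᶜ, F i j := by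
    rw [← Finset.sum_add_distrib]
    exact Finset.sum_congr rfl fun i _ => (Finset.sum_add_sum_compl U _).symm
  rw [Finset.sum_sub_distrib, h1, h2]
  ring

/-! ### Evolution of the backlog of a set of nodes -/

section Path

variable [Fintype N] [DecidableEq N] {D : EmbeddedDAG G} {c : Sym2 N → ℝ} {s d : N}
  {Q₀ : N → ℝ} {a : ℕ → ℝ} {Q : ℕ → N → ℝ} {F : ℕ → N → N → ℝ}

theorem IsBackpressurePath.backlog_succ (h : D.IsBackpressurePath c s d Q₀ a Q F) (t : ℕ) {n : N}
    (hn : n ≠ d) :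
    Q (t + 1) n = Q t n + (if n = s then a t else 0) + ∑ i, F t i n - ∑ j, F t n j := by
  convert h.update t n hn

theorem IsBackpressurePath.backlog_nonneg (h : D.IsBackpressurePath c s d Q₀ a Q F)
    (hQ₀ : ∀ n, 0 ≤ Q₀ n) (t : ℕ) (n : N) : 0 ≤ Q t n := by
  induction t generalizing n with
  | zero => rw [h.initial]; exact hQ₀ n
  | succ t ih =>
    by_cases hn : n = d
    · rw [hn, h.dest]
    · rw [h.backlog_succ t hn]
      have h1 := (h.slot t).sum_le_backlog n
      have h2 : 0 ≤ ∑ i, F t i n := Finset.sum_nonneg fun i _ => (h.slot t).nonneg i n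
      have h3 : 0 ≤ (if n = s then a t else 0) := by
        split_ifs
        · exact h.arrival_nonneg t
        · exact le_rfl
      linarith

/-- Transfers inside `U` cancel; only the flow across its boundary remains. -/
theorem IsBackpressurePath.sum_update (h : D.IsBackpressurePath c s d Q₀ a Q F) (t : ℕ)
    {U : Finset N} (hd : d ∉ U) :
    ∑ n ∈ U, Q (t + 1) n = ∑ n ∈ U, Q t n + (if s ∈ U then a t else 0)
      + ∑ i ∈ Uᶜ, ∑ j ∈ U, F t i j - ∑ i ∈ U, ∑ j ∈ Uᶜ, F t i j := by
  have h1 : ∑ n ∈ U, Q (t + 1) n = ∑ n ∈ U, (Q t n + (if n = s then a t else 0)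
      + (∑ i, F t i n - ∑ j, F t n j)) := by
    refine Finset.sum_congr rfl fun n hn => ?_
    rw [h.backlog_succ t fun hnd => hd (hnd ▸ hn)]
    ring
  rw [h1, Finset.sum_add_distrib, Finset.sum_add_distrib, sum_inflow_sub_outflow,
    Finset.sum_ite_eq']
  ring

/-- On the destination side of a min-cut, a set of nodes whose backlogs all exceed those of the
other nodes of that side does not gain backlog. -/
theorem IsBackpressurePath.sum_succ_le_of_gap (hc : ∀ e ∈ G.edgeSet, 0 ≤ c e)
    (h : D.IsBackpressurePath c s d Q₀ a Q F) {A : Finset N} (hA : D.IsMinCut c s d A) (t : ℕ)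
    {U : Finset N} (hU : U ⊆ Aᶜ) (hd : d ∉ U)
    (hbig : ∀ i ∈ U, D.cap c Finset.univ Finset.univ ≤ Q t i)
    (hgap : ∀ i ∈ U, ∀ j ∈ Aᶜ \ U, Q t j < Q t i) :
    ∑ n ∈ U, Q (t + 1) n ≤ ∑ n ∈ U, Q t n := by
  have hs : s ∉ U := fun hs => Finset.mem_compl.1 (hU hs) hA.1.1
  have e1 : Uᶜ = A ∪ Aᶜ \ U := by
    ext x
    have := @hU x
    simp only [Finset.mem_compl, Finset.mem_union, Finset.mem_sdiff] at this ⊢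
    tauto
  have hdis : Disjoint A (Aᶜ \ U) := Finset.disjoint_left.2 fun x hx hx' =>
    Finset.mem_compl.1 (Finset.mem_sdiff.1 hx').1 hx
  have hin : ∑ i ∈ Uᶜ, ∑ j ∈ U, F t i j ≤ D.cap c A U := by
    rw [e1, Finset.sum_union hdis,
      (h.slot t).flow_eq_zero fun i hi j hj => (hgap j hj i hi).le, add_zero]
    exact (h.slot t).flow_le_cap A U
  have hout : D.cap c U (Aᶜ \ U) ≤ ∑ i ∈ U, ∑ j ∈ Uᶜ, F t i j := by
    rw [← (h.slot t).flow_eq_cap hc (fun i hi j _ => hbig i hi) hgap]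
    refine Finset.sum_le_sum fun i _ => Finset.sum_le_sum_of_subset_of_nonneg ?_
      fun j _ _ => (h.slot t).nonneg i j
    rw [e1]
    exact Finset.subset_union_right
  rw [h.sum_update t hd, if_neg hs]
  linarith [hA.cap_le_cap_sdiff hU hd]

/-- On the source side of a cut, a set of nodes whose backlogs are all lower than those of the
other nodes of that side gains at least the arrivals and the capacity into it, less its capacity
across the cut. -/
theorem IsBackpressurePath.le_sum_succ_of_gap (hc : ∀ e ∈ G.edgeSet, 0 ≤ c e)
    (h : D.IsBackpressurePath c s d Q₀ a Q F) {A : Finset N} (hdA : d ∉ A) (t : ℕ)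
    {U : Finset N} (hU : U ⊆ A)
    (hbig : ∀ i ∈ A \ U, ∀ j ∈ U, D.cap c Finset.univ Finset.univ ≤ Q t i)
    (hgap : ∀ i ∈ A \ U, ∀ j ∈ U, Q t j < Q t i) :
    ∑ n ∈ U, Q t n + (if s ∈ U then a t else 0) + D.cap c (A \ U) U - D.cap c U Aᶜ ≤
      ∑ n ∈ U, Q (t + 1) n := by
  have e1 : Uᶜ = Aᶜ ∪ A \ U := by
    ext x
    have := @hU x
    simp only [Finset.mem_compl, Finset.mem_union, Finset.mem_sdiff]
    tauto
  have hdis : Disjoint Aᶜ (A \ U) := Finset.disjoint_left.2 fun x hx hx' =>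
    Finset.mem_compl.1 hx (Finset.mem_sdiff.1 hx').1
  have hin : D.cap c (A \ U) U ≤ ∑ i ∈ Uᶜ, ∑ j ∈ U, F t i j := by
    rw [← (h.slot t).flow_eq_cap hc hbig hgap, e1, Finset.sum_union hdis]
    linarith [(h.slot t).flow_nonneg Aᶜ U]
  have hout : ∑ i ∈ U, ∑ j ∈ Uᶜ, F t i j ≤ D.cap c U Aᶜ := by
    have h1 : ∑ i ∈ U, ∑ j ∈ Uᶜ, F t i j =
        ∑ i ∈ U, ∑ j ∈ Aᶜ, F t i j + ∑ i ∈ U, ∑ j ∈ A \ U, F t i j := by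
      rw [← Finset.sum_add_distrib]
      exact Finset.sum_congr rfl fun i _ => by rw [e1, Finset.sum_union hdis]
    rw [h1, (h.slot t).flow_eq_zero fun i hi j hj => (hgap j hj i hi).le, add_zero]
    exact (h.slot t).flow_le_cap U Aᶜ
  rw [h.sum_update t fun hd => hdA (hU hd)]
  linarith

/-! ### Inductive bounds over all subsets of a side -/

/-- The backlog of the sets on the destination side of a min-cut is bounded by a concave function
of their size. -/
theorem IsBackpressurePath.sum_le_concave (hc : ∀ e ∈ G.edgeSet, 0 ≤ c e)
    (h : D.IsBackpressurePath c s d Q₀ a Q F) (hQ₀ : ∀ n, 0 ≤ Q₀ n) {A : Finset N}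
    (hA : D.IsMinCut c s d A) {K : ℝ} (hK : ∑ n, Q₀ n ≤ K)
    (hK' : 2 * D.cap c Finset.univ Finset.univ + 1 ≤ K) (t : ℕ) {U : Finset N} (hU : U ⊆ Aᶜ)
    (hd : d ∉ U) :
    ∑ n ∈ U, Q t n ≤ K * (U.card * (2 * Fintype.card N - U.card)) := by
  have hC := D.cap_nonneg hc Finset.univ Finset.univ
  set C := D.cap c Finset.univ Finset.univ with hCdef
  have hcard : ∀ V : Finset N, (V.card : ℝ) ≤ Fintype.card N := fun V => by
    exact_mod_cast V.card_le_univ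
  induction t generalizing U with
  | zero =>
    rcases U.eq_empty_or_nonempty with rfl | hne
    · simp
    · have h1 : (1 : ℝ) ≤ U.card := by exact_mod_cast hne.card_pos
      have h2 : ∑ n ∈ U, Q 0 n ≤ ∑ n, Q₀ n := by
        rw [h.initial]
        exact Finset.sum_le_sum_of_subset_of_nonneg (Finset.subset_univ U) fun n _ _ => hQ₀ n
      have h3 : (1 : ℝ) ≤ U.card * (2 * Fintype.card N - U.card) := by
        nlinarith [hcard U]
      nlinarith
  | succ t ih =>
    by_cases hlow : ∑ n ∈ U, Q t n ≤ K * (U.card * (2 * Fintype.card N - U.card)) - C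
    · have hs : s ∉ U := fun hs => Finset.mem_compl.1 (hU hs) hA.1.1
      rw [h.sum_update t hd, if_neg hs]
      have h1 := (h.slot t).flow_le_cap Uᶜ U
      have h2 := D.cap_mono hc (Finset.subset_univ Uᶜ) (Finset.subset_univ U)
      have h3 := (h.slot t).flow_nonneg U Uᶜ
      linarith
    · push Not at hlow
      -- The bound for `U.erase i` forces `i` to carry nearly the whole last increment. With `2m` in
      -- place of `m`, increments stay at least `K` up to `u = m`.
      have hlarge : ∀ i ∈ U,
          K * (2 * Fintype.card N - 2 * U.card + 1) - C < Q t i := by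
        intro i hi
        have h1 := ih ((Finset.erase_subset i U).trans hU) fun h' => hd (Finset.mem_of_mem_erase h')
        have h2 := Finset.add_sum_erase U (Q t) hi
        have h3 : ((U.erase i).card : ℝ) = U.card - 1 := by
          rw [Finset.cast_card_erase_of_mem hi]
        rw [h3] at h1
        nlinarith
      have hpos : ∀ i ∈ U, C < Q t i := by
        intro i hi
        nlinarith [hlarge i hi, hcard U]
      refine (h.sum_succ_le_of_gap hc hA t hU hd (fun i hi => (hpos i hi).le) ?_).trans
        (ih hU hd)
      intro i hi j hj
      rw [Finset.mem_sdiff] at hj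
      -- The induction excludes sets containing `d`, but its backlog is zero.
      by_cases hjd : j = d
      · rw [hjd, h.dest]
        linarith [hpos i hi]
      -- The next increment is smaller by `2 * K`, which exceeds the slack `2 * C`.
      · have h1 := ih (U := insert j U) (Finset.insert_subset hj.1 hU) fun h' =>
          (Finset.mem_insert.1 h').elim (fun h'' => hjd h''.symm) hd
        rw [Finset.sum_insert hj.2, Finset.card_insert_of_notMem hj.2] at h1
        push_cast at h1
        nlinarith [hlarge i hi]

/-- The backlog of the sets on the source side of a cut, with the arrivals smoothed to the constant
rate `lam`, grows at least linearly up to a convex function of their size, if every low set with a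
gap above it gains at least `ε` in every slot. -/
theorem IsBackpressurePath.convex_le_sum (hc : ∀ e ∈ G.edgeSet, 0 ≤ c e)
    (h : D.IsBackpressurePath c s d Q₀ a Q F) (hQ₀ : ∀ n, 0 ≤ Q₀ n) {A : Finset N}
    (hdA : d ∉ A) {lam ε E K : ℝ} (hlam : 0 ≤ lam) (hε : 0 ≤ ε)
    (hgain : ∀ U ⊆ A, U.Nonempty →
      ε ≤ (if s ∈ U then lam else 0) + D.cap c (A \ U) U - D.cap c U Aᶜ)
    (hK : 2 * D.cap c Finset.univ Finset.univ + ε + E + 1 ≤ K) {T : ℕ}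
    (hE : ∀ t ≤ T, |∑ τ ∈ Finset.range t, a τ - lam * t| ≤ E) {t : ℕ} (ht : t ≤ T)
    {U : Finset N} (hU : U ⊆ A) :
    ε * (U.card / Fintype.card N) * t - K * (U.card * (2 * Fintype.card N - U.card)) ≤
      ∑ n ∈ U, (Q t n - if n = s then ∑ τ ∈ Finset.range t, a τ - lam * t else 0) := by
  have hC := D.cap_nonneg hc Finset.univ Finset.univ
  set C := D.cap c Finset.univ Finset.univ with hCdef
  have hE0 : 0 ≤ E := (abs_nonneg _).trans (hE t ht)
  have hK0 : 0 ≤ K := by linarith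
  have hcard : ∀ V : Finset N, (V.card : ℝ) ≤ Fintype.card N := fun V => by
    exact_mod_cast V.card_le_univ
  have hfrac : ∀ V : Finset N, (V.card : ℝ) / Fintype.card N ≤ 1 := fun V =>
    div_le_one_of_le₀ (hcard V) (Nat.cast_nonneg _)
  induction t generalizing U with
  | zero =>
    have h1 : 0 ≤ ∑ n ∈ U, Q 0 n := Finset.sum_nonneg fun n _ => h.backlog_nonneg hQ₀ 0 n
    have h2 : 0 ≤ K * (U.card * (2 * Fintype.card N - U.card)) := by
      have h3 : (0 : ℝ) ≤ 2 * Fintype.card N - U.card := by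
        linarith [hcard U, (Nat.cast_nonneg U.card : (0 : ℝ) ≤ U.card)]
      positivity
    have h3 : -(K * (U.card * (2 * Fintype.card N - U.card))) ≤ ∑ n ∈ U, Q 0 n := by linarith
    simpa using h3
  | succ t ih =>
    have ht' : t ≤ T := by omega
    set x : ℕ → N → ℝ := fun t n =>
      Q t n - if n = s then ∑ τ ∈ Finset.range t, a τ - lam * t else 0 with hx
    replace ih : ∀ {V : Finset N}, V ⊆ A →
        ε * (V.card / Fintype.card N) * t - K * (V.card * (2 * Fintype.card N - V.card)) ≤
          ∑ n ∈ V, x t n := fun hV => ih ht' hV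
    change _ ≤ ∑ n ∈ U, x (t + 1) n
    have hsum : ∀ t, ∑ n ∈ U, x t n = ∑ n ∈ U, Q t n
        - if s ∈ U then ∑ τ ∈ Finset.range t, a τ - lam * t else 0 := by
      intro t
      simp only [hx, Finset.sum_sub_distrib, Finset.sum_ite_eq']
    have hstep : ∑ n ∈ U, x (t + 1) n - ∑ n ∈ U, x t n =
        ∑ n ∈ U, Q (t + 1) n - ∑ n ∈ U, Q t n - (if s ∈ U then a t else 0)
          + if s ∈ U then lam else 0 := by
      rw [hsum, hsum]
      split_ifs
      · rw [Finset.sum_range_succ]; push_cast; ring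
      · ring
    rcases U.eq_empty_or_nonempty with rfl | hne
    · simp
    have hrate : ε * (U.card / Fintype.card N : ℝ) ≤ ε := by
      nlinarith [hfrac U]
    push_cast
    -- In one slot `U` sends out at most `C` and the bound rises by at most `ε`.
    by_cases hhigh : ε * (U.card / Fintype.card N) * t
        - K * (U.card * (2 * Fintype.card N - U.card)) + (C + ε) ≤ ∑ n ∈ U, x t n
    · have hQ := h.sum_update t fun hd => hdA (hU hd)
      have h1 := (h.slot t).flow_le_cap U Uᶜ
      have h2 := D.cap_mono hc (Finset.subset_univ U) (Finset.subset_univ Uᶜ)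
      have h3 := (h.slot t).flow_nonneg Uᶜ U
      have h4 : 0 ≤ (if s ∈ U then lam else 0) := by split_ifs <;> [exact hlam; exact le_rfl]
      linarith
    · push Not at hhigh
      have herr : ∀ n, |x t n - Q t n| ≤ E := by
        intro n
        simp only [hx]
        split_ifs
        · rw [sub_sub_cancel_left, abs_neg]; exact hE t ht'
        · simpa using hE0
      -- The time term is linear in `u` and drops out of the second difference, leaving `2 * K`;
      -- this pays the slack `2 * (C + ε)` and the smoothing error `2 * E`. The extra margin `C`
      -- makes the upper nodes' backlogs sufficient.
      have hgap : ∀ i ∈ A \ U, ∀ j ∈ U, Q t j + C < Q t i := by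
        intro i hi j hj
        rw [Finset.mem_sdiff] at hi
        have h1 := ih ((Finset.erase_subset j U).trans hU)
        have h2 := Finset.add_sum_erase U (x t) hj
        rw [Finset.cast_card_erase_of_mem hj] at h1
        have h3 := ih (Finset.insert_subset hi.1 hU)
        rw [Finset.sum_insert hi.2, Finset.card_insert_of_notMem hi.2] at h3
        push_cast at h3
        have h4 := abs_le.1 (herr i)
        have h5 := abs_le.1 (herr j)
        have h6 : ε * ((U.card - 1 : ℝ) / Fintype.card N) * t
            + ε * ((U.card + 1 : ℝ) / Fintype.card N) * t
            = 2 * (ε * ((U.card : ℝ) / Fintype.card N) * t) := by ring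
        nlinarith
      have h1 := h.le_sum_succ_of_gap hc hdA t hU
        (fun i hi j hj => by linarith [hgap i hi j hj, h.backlog_nonneg hQ₀ t j])
        (fun i hi j hj => by linarith [hgap i hi j hj])
      linarith [hgain U hU hne, ih hU]

end Path

/-! ### Uniform gain, arrival errors and the choice of time -/

/-- Every low set on the source side of a smallest min-cut below the arrival rate gains. -/
theorem IsSmallestMinCut.exists_gain [Fintype N] [DecidableEq N] {D : EmbeddedDAG G}
    {c : Sym2 N → ℝ} (hc : ∀ e ∈ G.edgeSet, 0 ≤ c e) {s d : N} {A : Finset N}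
    (hA : D.IsSmallestMinCut c s d A) {lam : ℝ} (hlam : D.cap c A Aᶜ < lam) :
    ∃ ε > 0, ∀ U ⊆ A, U.Nonempty →
      ε ≤ (if s ∈ U then lam else 0) + D.cap c (A \ U) U - D.cap c U Aᶜ := by
  have hpos : ∀ U : Finset N, U ⊆ A → U.Nonempty →
      0 < (if s ∈ U then lam else 0) + D.cap c (A \ U) U - D.cap c U Aᶜ := by
    intro U hU hne
    split_ifs with hs
    · linarith [D.cap_nonneg hc (A \ U) U, D.cap_mono hc hU (Finset.Subset.refl Aᶜ)]
    · linarith [hA.cap_lt_cap_sdiff hU hs hne]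
  -- There are finitely many `U`, so one small `ε` serves them all.
  have hev : ∀ᶠ ε in 𝓝[>] (0 : ℝ), ∀ U : Finset N, U ⊆ A → U.Nonempty →
      ε ≤ (if s ∈ U then lam else 0) + D.cap c (A \ U) U - D.cap c U Aᶜ := by
    refine Filter.eventually_all.2 fun U => ?_
    by_cases hU : U ⊆ A ∧ U.Nonempty
    · filter_upwards [Ioc_mem_nhdsGT (hpos U hU.1 hU.2)] with ε hε _ _ using hε.2
    · exact Filter.Eventually.of_forall fun ε h1 h2 => absurd ⟨h1, h2⟩ hU
  obtain ⟨ε, h1, h2⟩ := (hev.and self_mem_nhdsWithin).exists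
  exact ⟨ε, h2, h1⟩

end EmbeddedDAG

/-- If the averages of `a` tend to `lam`, the partial sums up to time `T` stay within `η T` of
their trend for all large `T`. -/
theorem eventually_abs_sum_sub_le {a : ℕ → ℝ} {lam : ℝ}
    (h : Tendsto (fun t : ℕ => (1 / (t : ℝ)) * ∑ τ ∈ Finset.range t, a τ) atTop (𝓝 lam))
    {η : ℝ} (hη : 0 < η) :
    ∀ᶠ T : ℕ in atTop, ∀ t ≤ T, |∑ τ ∈ Finset.range t, a τ - lam * t| ≤ η * T := by
  obtain ⟨t₀, ht₀⟩ := Filter.eventually_atTop.1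
    ((Metric.tendsto_nhds.1 h η hη).and (eventually_gt_atTop 0))
  have hlarge : ∀ t ≥ t₀, |∑ τ ∈ Finset.range t, a τ - lam * t| ≤ η * t := by
    intro t ht
    obtain ⟨h1, h2⟩ := ht₀ t ht
    have h2' : (0 : ℝ) < t := by exact_mod_cast h2
    have h3 : ∑ τ ∈ Finset.range t, a τ - lam * t
        = ((1 / (t : ℝ)) * ∑ τ ∈ Finset.range t, a τ - lam) * t := by
      field_simp
    rw [Real.dist_eq] at h1
    rw [h3, abs_mul, abs_of_pos h2']
    exact mul_le_mul_of_nonneg_right h1.le h2'.le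
  -- The finitely many errors before `t₀` have a fixed sum, eventually below `η * T`.
  have hB : ∀ᶠ T : ℕ in atTop,
      ∑ t ∈ Finset.range t₀, |∑ τ ∈ Finset.range t, a τ - lam * t| ≤ η * T :=
    (tendsto_natCast_atTop_atTop.const_mul_atTop hη).eventually_ge_atTop _
  filter_upwards [hB] with T hT t htT
  rcases le_or_gt t₀ t with ht | ht
  · refine (hlarge t ht).trans (mul_le_mul_of_nonneg_left ?_ hη.le)
    exact_mod_cast htT
  · exact (Finset.single_le_sum
      (f := fun t : ℕ => |∑ τ ∈ Finset.range t, a τ - lam * t|)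
      (fun _ _ => abs_nonneg _) (Finset.mem_range.2 ht)).trans hT

namespace EmbeddedDAG

/-- For an arrival sequence with averages tending to `lam`, the backlogs on the source side of the
smallest min-cut exceed `R` at a time that depends only on the arrivals. -/
theorem IsSmallestMinCut.exists_time_lt_backlog {N : Type*} {G : SimpleGraph N} [Fintype N]
    [DecidableEq N] {D : EmbeddedDAG G} {c : Sym2 N → ℝ} (hc : ∀ e ∈ G.edgeSet, 0 ≤ c e) {s d : N}
    {A : Finset N} (hA : D.IsSmallestMinCut c s d A) {lam : ℝ} (hlam : D.cap c A Aᶜ < lam)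
    {Q₀ : N → ℝ} (hQ₀ : ∀ n, 0 ≤ Q₀ n) (R : ℝ) {a : ℕ → ℝ}
    (ha : Tendsto (fun t : ℕ => (1 / (t : ℝ)) * ∑ τ ∈ Finset.range t, a τ) atTop (𝓝 lam)) :
    ∃ T : ℕ, ∀ (Q : ℕ → N → ℝ) (F : ℕ → N → N → ℝ), D.IsBackpressurePath c s d Q₀ a Q F →
      ∀ n ∈ A, R < Q T n := by
  obtain ⟨ε, hε, hgain⟩ := hA.exists_gain hc hlam
  set C := D.cap c Finset.univ Finset.univ with hC
  have hm : (0 : ℝ) < (Fintype.card N : ℝ) := by exact_mod_cast Fintype.card_pos_iff.2 ⟨s⟩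
  set m : ℝ := (Fintype.card N : ℝ) with hmdef
  -- `K` below contains the error `η * T`, weighted by `2 * m - 1` on a singleton; smoothing at `s`
  -- costs one more. The total `2 * m * η * T` is half the growth `ε * T / m`.
  set η : ℝ := ε / (4 * m * m) with hηdef
  have hη : 0 < η := by positivity
  have hbig : ∀ᶠ T : ℕ in atTop,
      (2 * C + ε + 1) * (2 * m - 1) + R < (ε / (2 * m)) * (T : ℝ) :=
    (tendsto_natCast_atTop_atTop.const_mul_atTop (by positivity)).eventually_gt_atTop _
  obtain ⟨T, hE, hT⟩ := ((eventually_abs_sum_sub_le ha hη).and hbig).exists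
  refine ⟨T, fun Q F h n hn => ?_⟩
  have hlam0 : 0 ≤ lam := (D.cap_nonneg hc A Aᶜ).trans hlam.le
  have h1 := h.convex_le_sum hc hQ₀ hA.1.1.2 hlam0 hε.le hgain
    (K := 2 * C + ε + η * T + 1) le_rfl hE le_rfl (Finset.singleton_subset_iff.2 hn)
  rw [Finset.sum_singleton, Finset.card_singleton, Nat.cast_one, ← hmdef] at h1
  have h2 : (Q T n - if n = s then ∑ τ ∈ Finset.range T, a τ - lam * T else 0)
      ≤ Q T n + η * T := by
    split_ifs
    · linarith [(abs_le.1 (hE T le_rfl)).1]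
    · have : 0 ≤ η * T := by positivity
      linarith
  have h3 : ε * (1 / m) * T - η * T * (2 * m) = ε / (2 * m) * T := by
    rw [hηdef]; field_simp; ring
  linarith

end EmbeddedDAG

theorem theorem3 {N : Type*} [Fintype N] [DecidableEq N] (G : SimpleGraph N)
    (c : Sym2 N → ℝ) (hc : ∀ e ∈ G.edgeSet, 0 ≤ c e)
    (D : EmbeddedDAG G) (s d : N)
    (A : Finset N) (hA : D.IsSmallestMinCut c s d A)
    (lam : ℝ) (hlam : D.cap c A Aᶜ < lam)
    (Q₀ : N → ℝ) (hQ₀ : ∀ n, 0 ≤ Q₀ n) (hQ₀d : Q₀ d = 0) :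
    ∃ (R : ℝ) (T : (ℕ → ℝ) → ℕ),
      ∀ {Ω : Type*} [MeasurableSpace Ω] (P : Measure Ω) [IsProbabilityMeasure P]
        (a : ℕ → Ω → ℝ) (Q : ℕ → Ω → N → ℝ) (F : ℕ → Ω → N → N → ℝ),
        (∀ᵐ ω ∂P, Tendsto (fun t : ℕ => (1 / (t : ℝ)) * ∑ τ ∈ Finset.range t, a τ ω)
          atTop (𝓝 lam)) →
        (∀ᵐ ω ∂P, D.IsBackpressurePath c s d Q₀
          (fun t => a t ω) (fun t => Q t ω) (fun t => F t ω)) →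
        ∀ᵐ ω ∂P,
          (∃ t < T (fun τ => a τ ω), ∀ n ∈ A, R < Q t ω n) ∧
          (∀ t, ∀ n ∉ A, Q t ω n < R) := by
  classical
  set K : ℝ := ∑ n, Q₀ n + (2 * D.cap c Finset.univ Finset.univ + 1) with hK
  have hC := D.cap_nonneg hc Finset.univ Finset.univ
  have hQsum : 0 ≤ ∑ n, Q₀ n := Finset.sum_nonneg fun n _ => hQ₀ n
  -- The concave bound for a singleton, plus one for strictness.
  set R : ℝ := K * (1 * (2 * Fintype.card N - 1)) + 1 with hR
  have hm : (1 : ℝ) ≤ Fintype.card N := by exact_mod_cast Fintype.card_pos_iff.2 ⟨s⟩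
  -- The time works for every path with these arrivals, so it depends on `a` alone. The value `0` is
  -- taken only on a null event; `+ 1` makes `t < T` strict.
  refine ⟨R, fun a => if ha : Tendsto (fun t : ℕ => (1 / (t : ℝ)) * ∑ τ ∈ Finset.range t, a τ)
      atTop (𝓝 lam) then (hA.exists_time_lt_backlog hc hlam hQ₀ R ha).choose + 1 else 0, ?_⟩
  intro Ω _ P _ a Q F ha hpath
  filter_upwards [ha, hpath] with ω haω hω
  refine ⟨⟨_, ?_, (hA.exists_time_lt_backlog hc hlam hQ₀ R haω).choose_spec _ _ hω⟩, ?_⟩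
  · rw [dif_pos haω]
    exact Nat.lt_succ_self _
  · intro t n hn
    by_cases hnd : n = d
    · have h0 := hω.dest t
      rw [hnd]
      change Q t ω d = 0 at h0
      rw [h0, hR]
      have : 0 ≤ K * (1 * (2 * Fintype.card N - 1)) :=
        mul_nonneg (by linarith) (by linarith)
      linarith
    · have h1 := hω.sum_le_concave hc hQ₀ hA.1 (K := K) (by linarith) (by linarith) t
        (Finset.singleton_subset_iff.2 (Finset.mem_compl.2 hn))
        (fun h => hnd (Finset.mem_singleton.1 h).symm)
      rw [Finset.sum_singleton, Finset.card_singleton, Nat.cast_one] at h1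
      linarith
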